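/- Let $n\ge 1$ and $\sigma>0$, and let $\mathcal S_n^\uparrow=\{u\in\mathbb R^n: u_1\le u_2\le\dots\le u_n\}$ be the cone of nondecreasing sequences. For $u\in\mathbb R^n$ write $\|u\|_n^2=\frac1n\sum_{i=1}^n u_i^2$, and for $u\in\mathcal S_n^\uparrow$ let $k(u)=|\{u_i: i=1,\dots,n\}|$ be its number of constant pieces. For $\mu\in\mathbb R^n$ let $\mathbb P_\mu$ be the law of the observation $y=\mu+\xi$, where $\xi\sim\mathcal N(0,\sigma^2 I_{n\times n})$. Let $\hat\mu^{LS}=\hat\mu^{LS}(y)$ be the isotonic least squares estimator, that is, the unique minimizer of $\|y-u\|_n^2$ over $u\in\mathcal S_n^\uparrow$, let $\hat k=k(\hat\mu^{LS})$, and for $\alpha\in(0,1)$ put $$\hat r_\uparrow=\frac{\sigma^2\,\hat k\,\bigl(2+22\log n+10\log(1/\alpha)\bigr)}{n}.$$ Then, for every $\alpha\in(0,1)$: 1. for every $\mu\in\mathcal S_n^\uparrow$, $\;\mathbb P_\mu\bigl(\|\hat\mu^{LS}-\mu\|_n^2\le\hat r_\uparrow\bigr)\ge 1-\alpha$; 2.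 consequently the ball $\hat C_n(y)=\{v\in\mathbb R^n:\|\hat\mu^{LS}-v\|_n^2\le\hat r_\uparrow\}$ is an honest confidence set over $\mathcal S_n^\uparrow$: it depends measurably on the data (the set $\{(y,v): v\in\hat C_n(y)\}$ is a Borel subset of $\mathbb R^n\times\mathbb R^n$), and it has uniform coverage, $\;\inf_{\mu\in\mathcal S_n^\uparrow}\mathbb P_\mu\bigl(\mu\in\hat C_n(y)\bigr)\ge 1-\alpha$. -/

import Mathlib

open MeasureTheory ProbabilityTheory
open scoped ENNReal

/-- The squared scaled norm `‖u‖²_n = (1/n) ∑ u_i²` on `ℝⁿ`. -/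
noncomputable def scaledNormSq {n : ℕ} (u : EuclideanSpace ℝ (Fin n)) : ℝ :=
  (1 / (n : ℝ)) * ∑ i, u i ^ 2

/-- The cone of nondecreasing sequences in `ℝⁿ`. -/
def nondecreasingCone (n : ℕ) : Set (EuclideanSpace ℝ (Fin n)) :=
  {u | Monotone fun i => u i}

/-- The number of distinct values of `u`. For nondecreasing `u` this is the number of constant
pieces of `u`. -/
noncomputable def numPieces {n : ℕ} (u : EuclideanSpace ℝ (Fin n)) : ℕ :=
  (Set.range fun i => u i).ncard

theorem scaledNormSq_eq_norm {n : ℕ} (u : EuclideanSpace ℝ (Fin n)) :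
    scaledNormSq u = (1 / (n : ℝ)) * ‖u‖ ^ 2 := by
  simp [scaledNormSq, EuclideanSpace.norm_sq_eq]

/-- The least squares problem over the cone of nondecreasing sequences has exactly one solution. -/
theorem existsUnique_isotonicLSE {n : ℕ} (y : EuclideanSpace ℝ (Fin n)) :
    ∃! m : EuclideanSpace ℝ (Fin n), m ∈ nondecreasingCone n ∧
      ∀ u ∈ nondecreasingCone n, scaledNormSq (y - m) ≤ scaledNormSq (y - u) := by
  rcases Nat.eq_zero_or_pos n with rfl | hn
  · exact ⟨0, ⟨fun i => i.elim0, fun u _ => by simp [scaledNormSq]⟩,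
      fun m _ => Subsingleton.elim _ _⟩
  have hn' : (0 : ℝ) < 1 / (n : ℝ) := by positivity
  have hne : (nondecreasingCone n).Nonempty := ⟨0, fun i j _ => by simp⟩
  have hcl : IsClosed (nondecreasingCone n) := by
    have h : nondecreasingCone n =
        ⋂ (i : Fin n) (j : Fin n) (_ : i ≤ j), {u : EuclideanSpace ℝ (Fin n) | u i ≤ u j} := by
      ext u
      simp [nondecreasingCone, Monotone]
    rw [h]
    refine isClosed_iInter fun i => isClosed_iInter fun j => isClosed_iInter fun _ => ?_
    exact isClosed_le (by fun_prop) (by fun_prop)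
  have hcv : Convex ℝ (nondecreasingCone n) := by
    intro u hu v hv a b ha hb _ i j hij
    have h1 := mul_le_mul_of_nonneg_left (hu hij) ha
    have h2 := mul_le_mul_of_nonneg_left (hv hij) hb
    simpa using add_le_add h1 h2
  have key : ∀ m u : EuclideanSpace ℝ (Fin n),
      scaledNormSq (y - m) ≤ scaledNormSq (y - u) ↔ ‖y - m‖ ≤ ‖y - u‖ := by
    intro m u
    rw [scaledNormSq_eq_norm, scaledNormSq_eq_norm, mul_le_mul_iff_right₀ hn',
      sq_le_sq₀ (norm_nonneg _) (norm_nonneg _)]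
  have hinf : ∀ m ∈ nondecreasingCone n,
      (∀ u ∈ nondecreasingCone n, ‖y - m‖ ≤ ‖y - u‖) →
        ‖y - m‖ = ⨅ w : nondecreasingCone n, ‖y - w‖ := by
    intro m hm h
    have : Nonempty (nondecreasingCone n) := hne.to_subtype
    refine le_antisymm (le_ciInf fun w => h w w.2) ?_
    exact ciInf_le (f := fun w : nondecreasingCone n => ‖y - w‖)
      ⟨0, by rintro _ ⟨w, rfl⟩; exact norm_nonneg _⟩ ⟨m, hm⟩
  obtain ⟨m, hm, hmin⟩ := exists_norm_eq_iInf_of_complete_convex hne hcl.isComplete hcv y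
  refine ⟨m, ⟨hm, fun u hu => (key m u).2 ?_⟩, ?_⟩
  · rw [hmin]
    exact ciInf_le (f := fun w : nondecreasingCone n => ‖y - w‖)
      ⟨0, by rintro _ ⟨w, rfl⟩; exact norm_nonneg _⟩ ⟨u, hu⟩
  · rintro m' ⟨hm', h'⟩
    have e' := hinf m' hm' fun u hu => (key m' u).1 (h' u hu)
    have i1 := (norm_eq_iInf_iff_real_inner_le_zero hcv hm).1 hmin m' hm'
    have i2 := (norm_eq_iInf_iff_real_inner_le_zero hcv hm').1 e' m hm
    have h3 : inner ℝ (m' - m) (m' - m) ≤ 0 := by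
      have : inner ℝ (m' - m) (m' - m) =
          inner ℝ (y - m) (m' - m) + inner ℝ (y - m') (m - m') := by
        simp only [inner_sub_left, inner_sub_right, real_inner_comm]
        ring
      linarith
    rw [real_inner_self_eq_norm_sq] at h3
    exact sub_eq_zero.1 (norm_eq_zero.1 (by nlinarith [norm_nonneg (m' - m)]))

/-- The isotonic least squares estimator: the unique minimiser of `‖y - u‖²_n` over nondecreasing
sequences `u`. -/
noncomputable def isotonicLSE {n : ℕ} (y : EuclideanSpace ℝ (Fin n)) :
    EuclideanSpace ℝ (Fin n) :=
  (existsUnique_isotonicLSE y).choose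

/-- The defining property of the isotonic least squares estimator. -/
theorem isotonicLSE_spec {n : ℕ} (y : EuclideanSpace ℝ (Fin n)) :
    isotonicLSE y ∈ nondecreasingCone n ∧
      ∀ u ∈ nondecreasingCone n, scaledNormSq (y - isotonicLSE y) ≤ scaledNormSq (y - u) :=
  (existsUnique_isotonicLSE y).choose_spec.1

/-- The statistic `σ² k̂ (2 + 22 log n + 10 log (1/α)) / n`, where `k̂` is the number of constant
pieces of the isotonic least squares estimator. -/
noncomputable def rHatUp {n : ℕ} (σ α : ℝ) (y : EuclideanSpace ℝ (Fin n)) : ℝ :=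
  σ ^ 2 * (numPieces (isotonicLSE y) : ℝ) *
    (2 + 22 * Real.log n + 10 * Real.log (1 / α)) / n

/-- The law of the observation `y = μ + ξ`, where the noise `ξ` has the Gaussian distribution
`N(0, σ² I)` on `ℝⁿ`. -/
noncomputable def observationLaw {n : ℕ} (μ : EuclideanSpace ℝ (Fin n)) (σ : ℝ) :
    Measure (EuclideanSpace ℝ (Fin n)) :=
  (multivariateGaussian (0 : EuclideanSpace ℝ (Fin n))
    (σ ^ 2 • (1 : Matrix (Fin n) (Fin n) ℝ))).map fun ξ => μ + ξ

/-- The ball `{v : ‖μ̂ - v‖²_n ≤ r̂}` centred at the isotonic least squares estimator `μ̂`, whose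
radius in the scaled norm is the square root of `r̂ = rHatUp σ α y`. -/
noncomputable def confidenceBall {n : ℕ} (σ α : ℝ) (y : EuclideanSpace ℝ (Fin n)) :
    Set (EuclideanSpace ℝ (Fin n)) :=
  {v | scaledNormSq (isotonicLSE y - v) ≤ rHatUp σ α y}

/-- A data-driven region `C = C(y)` is an honest confidence set over `K` at level `1 - α`: it
depends measurably on the data, and `inf_{μ ∈ K} P_μ (μ ∈ C(y)) ≥ 1 - α`. -/
def IsHonestConfidenceSet {n : ℕ} (K : Set (EuclideanSpace ℝ (Fin n))) (σ α : ℝ)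
    (C : EuclideanSpace ℝ (Fin n) → Set (EuclideanSpace ℝ (Fin n))) : Prop :=
  MeasurableSet {p : EuclideanSpace ℝ (Fin n) × EuclideanSpace ℝ (Fin n) | p.2 ∈ C p.1} ∧
    ENNReal.ofReal (1 - α) ≤ ⨅ μ ∈ K, observationLaw μ σ {y | μ ∈ C y}

/-!
Write `y = μ + σ g` with `g` standard Gaussian, and let `h = μ̂ - μ`. Since `μ̂` is the projection
of `y` onto a convex cone containing `μ`, `‖h‖² ≤ σ ⟪g, h⟫`. On a constant piece `I` of `μ̂`, which
is an interval, `h` is nonincreasing. With `P_I` the projection onto the cone of sequences supported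
and nonincreasing on `I`, splitting `2 σ ⟪g, h⟫ - ‖h‖²` over the pieces gives
`‖h‖² ≤ σ² ∑_I ‖P_I g‖² ≤ σ² k̂ max_I ‖P_I g‖²` (`norm_sq_isotonicLSE_sub_le_numPieces_mul`). It
remains to bound `‖P_I g‖²` by `2 + 22 log n + 10 log (1 / α)` simultaneously for all
`n (n + 1) / 2` intervals, which a union bound does (`stdGaussian_exists_antitone_gt_le`) once the
tail of a single `W = ‖P_I g‖²` is controlled.

The function `W` is continuously differentiable in `g`, with gradient `2 P_I g` of squared norm
`4 W`. The Maurey–Pisier rotation argument therefore closes on itself: it yields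
`𝔼 exp (l W) ≤ exp (l 𝔼 W / (1 - l π² / 2))` for `l π² / 2 < 1`
(`IsConeProjection.lintegral_exp_norm_sq_le`).

For the mean, `𝔼 W ≤ 2 (1 + log n)` (`integral_norm_sq_le_log`): the positive part of a
nonincreasing sequence sees `g` only through its maximal averages over initial segments, the
negative part through those over final segments. By a reflection argument
(`measure_exists_lt_inner_le`) the maximum of the averages over the segments containing the first
`i` points has second moment at most `1 / i`, and these bounds add up to a harmonic number. For
`n ≤ 3` the trivial bound `𝔼 W ≤ n` is used instead.
-/

/-! ### Projections onto convex cones -/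

section ConeProjection

variable {E : Type*} [NormedAddCommGroup E] [InnerProductSpace ℝ E]

/-- `P` behaves like the metric projection onto a closed convex cone. The cone itself is not
recorded: for `P` with values in a cone `K`, the two fields follow from Moreau's conditions
`⟪x - P x, P x⟫ = 0` and `⟪x - P x, u⟫ ≤ 0` for `u ∈ K`, and they suffice for the analysis of
`x ↦ ‖P x‖²`. -/
structure IsConeProjection (P : E → E) : Prop where
  inner_self : ∀ x, inner ℝ x (P x) = ‖P x‖ ^ 2
  inner_le : ∀ x y, inner ℝ x (P y) ≤ inner ℝ (P x) (P y)

namespace IsConeProjection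

variable {P : E → E} (hP : IsConeProjection P)
include hP

theorem norm_sub_le (x y : E) : ‖P x - P y‖ ≤ ‖x - y‖ := by
  have h1 := hP.inner_self x
  have h2 := hP.inner_self y
  have h3 := hP.inner_le x y
  have h4 := hP.inner_le y x
  have h5 : ‖P x - P y‖ ^ 2 ≤ inner ℝ (x - y) (P x - P y) := by
    rw [norm_sub_sq_real, inner_sub_left, inner_sub_right, inner_sub_right]
    rw [real_inner_comm (P x) (P y)] at h4
    linarith
  have h6 := real_inner_le_norm (x - y) (P x - P y)
  by_contra! h
  nlinarith [norm_nonneg (x - y), norm_nonneg (P x - P y)]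

theorem continuous : Continuous P :=
  (LipschitzWith.of_dist_le_mul (K := 1) fun x y => by
    simpa [dist_eq_norm] using hP.norm_sub_le x y).continuous

theorem norm_le (x : E) : ‖P x‖ ≤ ‖x‖ := by
  have h1 := hP.inner_self x
  have h6 := real_inner_le_norm x (P x)
  by_contra! h
  nlinarith [norm_nonneg x, norm_nonneg (P x)]

theorem two_mul_inner_sub_le (x y : E) :
    2 * inner ℝ y (P x) - ‖P x‖ ^ 2 ≤ ‖P y‖ ^ 2 := by
  have h3 := hP.inner_le y x
  have h5 := sq_nonneg ‖P y - P x‖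
  rw [norm_sub_sq_real] at h5
  linarith

/-- `x ↦ ‖P x‖²` is differentiable with gradient `2 P x`, although `P` itself need not be
differentiable: the first-order remainder lies between `0` and `2 ‖z - x‖²`. -/
theorem hasFDerivAt_norm_sq (x : E) :
    HasFDerivAt (fun z => ‖P z‖ ^ 2) ((2 : ℝ) • innerSL ℝ (P x)) x := by
  rw [hasFDerivAt_iff_isLittleO]
  refine Asymptotics.IsBigO.trans_isLittleO (g := fun z => ‖z - x‖ ^ 2) ?_ ?_
  · refine Asymptotics.IsBigO.of_bound 2 (Filter.Eventually.of_forall fun z => ?_)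
    have h1 := hP.two_mul_inner_sub_le x z
    have h2 := hP.two_mul_inner_sub_le z x
    have h3 := hP.inner_self x
    have h4 := hP.inner_self z
    have h5 := (real_inner_le_norm (z - x) (P z - P x)).trans
      (mul_le_mul_of_nonneg_left (hP.norm_sub_le z x) (norm_nonneg _))
    simp only [inner_sub_left, inner_sub_right] at h5
    simp only [FunLike.coe_smul, Pi.smul_apply, innerSL_apply_apply, inner_sub_right,
      smul_eq_mul, Real.norm_eq_abs, abs_pow, abs_norm]
    rw [real_inner_comm z, real_inner_comm x]
    rw [abs_le]
    constructor <;> nlinarith [sq_nonneg ‖z - x‖]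
  · have : Filter.Tendsto (fun z => ‖z - x‖) (nhds x) (nhds 0) := by
      have : Continuous fun z => ‖z - x‖ := by fun_prop
      simpa using this.tendsto x
    have h := (Asymptotics.isLittleO_one_iff ℝ).2 this
    have h2 := h.mul_isBigO (Asymptotics.isBigO_refl (fun z => ‖z - x‖) (nhds x))
    simp only [one_mul, ← sq] at h2
    exact Asymptotics.isLittleO_norm_right.1 h2

theorem hasDerivAt_norm_sq_rotation (x y : E) (t : ℝ) :
    HasDerivAt (fun s => ‖P (ContinuousLinearMap.rotation s (x, y)).1‖ ^ 2)
      (2 * inner ℝ (P (ContinuousLinearMap.rotation t (x, y)).1)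
        (ContinuousLinearMap.rotation t (x, y)).2) t := by
  have h1 : HasDerivAt (fun s => (ContinuousLinearMap.rotation s (x, y)).1)
      (ContinuousLinearMap.rotation t (x, y)).2 t := by
    simp only [ContinuousLinearMap.rotation_apply]
    exact ((Real.hasDerivAt_cos t).smul_const x).add ((Real.hasDerivAt_sin t).smul_const y)
  have h2 := (hP.hasFDerivAt_norm_sq (ContinuousLinearMap.rotation t (x, y)).1).comp_hasDerivAt t h1
  exact h2.congr_deriv (by simp)

/-- The increment of `‖P ·‖²` from `x` to `y` is the integral of its derivative along the quarter
circle from `x` to `y`; Jensen's inequality moves the exponential inside that integral. -/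
theorem exp_norm_sq_sub_le (l : ℝ) (x y : E) :
    ENNReal.ofReal (Real.exp (l * (‖P y‖ ^ 2 - ‖P x‖ ^ 2))) ≤
      ENNReal.ofReal (2 / Real.pi) * ∫⁻ t in Set.Ioc 0 (Real.pi / 2),
        ENNReal.ofReal (Real.exp (l * Real.pi *
          inner ℝ (P (ContinuousLinearMap.rotation t (x, y)).1)
            (ContinuousLinearMap.rotation t (x, y)).2)) := by
  have hpi := Real.pi_pos
  have hPc := hP.continuous
  set f : ℝ → ℝ := fun t => inner ℝ (P (ContinuousLinearMap.rotation t (x, y)).1)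
            (ContinuousLinearMap.rotation t (x, y)).2 with hf
  have hfc : Continuous f := by
    simp only [hf, ContinuousLinearMap.rotation_apply]
    fun_prop
  have hftc : ∫ t in (0)..(Real.pi / 2), 2 * f t = ‖P y‖ ^ 2 - ‖P x‖ ^ 2 := by
    rw [intervalIntegral.integral_eq_sub_of_hasDerivAt
      (fun t _ => hP.hasDerivAt_norm_sq_rotation x y t)
      ((continuous_const.mul hfc).intervalIntegrable _ _)]
    simp [ContinuousLinearMap.rotation_apply]
  rw [intervalIntegral.integral_of_le (by positivity)] at hftc
  have hint : ∀ g : ℝ → ℝ, Continuous g →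
      IntegrableOn g (Set.Ioc 0 (Real.pi / 2)) := fun g hg =>
    (hg.integrableOn_Icc).mono_set Set.Ioc_subset_Icc_self
  have hvol : (volume (Set.Ioc 0 (Real.pi / 2))).toReal = Real.pi / 2 := by
    rw [Real.volume_Ioc, sub_zero, ENNReal.toReal_ofReal (by positivity)]
  have hjen := convexOn_exp.map_set_average_le (μ := volume) (t := Set.Ioc 0 (Real.pi / 2))
    (f := fun t => l * Real.pi * f t) Real.continuous_exp.continuousOn isClosed_univ
    (by simp [hpi]) (by simp) (by simp) (hint _ (by fun_prop))
    (hint _ (by unfold Function.comp; fun_prop))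
  rw [setAverage_eq, setAverage_eq, measureReal_def, hvol] at hjen
  have e1 : (Real.pi / 2)⁻¹ • ∫ t in Set.Ioc 0 (Real.pi / 2), l * Real.pi * f t
      = l * (‖P y‖ ^ 2 - ‖P x‖ ^ 2) := by
    rw [← hftc, integral_const_mul, integral_const_mul, smul_eq_mul]
    field_simp
  rw [e1] at hjen
  rw [← ofReal_integral_eq_lintegral_ofReal (hint _ (by fun_prop))
    (Filter.Eventually.of_forall fun t => (Real.exp_pos _).le),
    ← ENNReal.ofReal_mul (by positivity)]
  apply ENNReal.ofReal_le_ofReal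
  rw [inv_div, smul_eq_mul] at hjen
  exact hjen

end IsConeProjection

end ConeProjection

/-! ### Gaussian concentration of the squared norm of a cone projection -/

section Gaussian

variable {E : Type*} [NormedAddCommGroup E] [InnerProductSpace ℝ E] [FiniteDimensional ℝ E]
  [MeasurableSpace E] [BorelSpace E]

theorem stdGaussian_map_inner (a : E) :
    (stdGaussian E).map (fun x => inner ℝ a x) = gaussianReal 0 (‖a‖ ^ 2).toNNReal := by
  have h := IsGaussian.map_eq_gaussianReal (μ := stdGaussian E) (innerSL ℝ a)
  rw [variance_dual_stdGaussian, integral_strongDual_stdGaussian, innerSL_apply_norm] at h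
  exact h

theorem lintegral_exp_inner_stdGaussian (a : E) :
    ∫⁻ x, ENNReal.ofReal (Real.exp (inner ℝ a x)) ∂(stdGaussian E) =
      ENNReal.ofReal (Real.exp (‖a‖ ^ 2 / 2)) := by
  have h1 : ∫⁻ x, ENNReal.ofReal (Real.exp (inner ℝ a x)) ∂(stdGaussian E) =
      ∫⁻ s, ENNReal.ofReal (Real.exp s) ∂(gaussianReal 0 (‖a‖ ^ 2).toNNReal) := by
    rw [← stdGaussian_map_inner, lintegral_map (by fun_prop) (by fun_prop)]
  have h2 := integrable_exp_mul_gaussianReal (μ := 0) (v := (‖a‖ ^ 2).toNNReal) 1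
  simp only [one_mul] at h2
  rw [h1, ← ofReal_integral_eq_lintegral_ofReal h2
    (Filter.Eventually.of_forall fun t => (Real.exp_pos _).le)]
  have h3 := congrFun (mgf_fun_id_gaussianReal (μ := 0) (v := (‖a‖ ^ 2).toNNReal)) 1
  simp only [mgf, one_mul] at h3
  rw [h3]
  simp

theorem lintegral_inner_sq_stdGaussian (a : E) :
    ∫⁻ x, ENNReal.ofReal (inner ℝ a x ^ 2) ∂(stdGaussian E) = ENNReal.ofReal (‖a‖ ^ 2) := by
  have h := variance_dual_stdGaussian (innerSL ℝ a)
  have hm : MemLp (fun x => inner ℝ a x) 2 (stdGaussian E) :=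
    IsGaussian.memLp_dual (stdGaussian E) (innerSL ℝ a) 2 (by simp)
  rw [innerSL_apply_norm, variance_of_integral_eq_zero (by fun_prop)
    (integral_strongDual_stdGaussian _)] at h
  rw [← h]
  exact (ofReal_integral_eq_lintegral_ofReal hm.integrable_sq
    (Filter.Eventually.of_forall fun t => sq_nonneg _)).symm

namespace IsConeProjection

variable {P : E → E} (hP : IsConeProjection P)
include hP

/-- The Maurey–Pisier symmetrization for `‖P ·‖²`. Position and velocity on the quarter circle
between two independent standard Gaussian vectors are again independent and standard Gaussian, and
integrating out the velocity `v` in `exp (l π ⟪P u, v⟫)` leaves `exp (l² π² ‖P u‖² / 2)`. -/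
theorem lintegral_exp_norm_sq_mul_le (l : ℝ) :
    (∫⁻ x, ENNReal.ofReal (Real.exp (l * ‖P x‖ ^ 2)) ∂(stdGaussian E)) *
      (∫⁻ x, ENNReal.ofReal (Real.exp (-l * ‖P x‖ ^ 2)) ∂(stdGaussian E)) ≤
    ∫⁻ x, ENNReal.ofReal (Real.exp (l ^ 2 * Real.pi ^ 2 / 2 * ‖P x‖ ^ 2)) ∂(stdGaussian E) := by
  have hPc := hP.continuous
  have hpi := Real.pi_pos
  set γ := stdGaussian E
  set F : E × E → ℝ≥0∞ := fun q =>
    ENNReal.ofReal (Real.exp (l * Real.pi * inner ℝ (P q.1) q.2)) with hF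
  have hFc : Continuous F := by
    simp only [hF]
    exact ENNReal.continuous_ofReal.comp (by fun_prop)
  have hrot : ∀ t : ℝ, ∫⁻ p, F (ContinuousLinearMap.rotation t p) ∂(γ.prod γ)
      = ∫⁻ q, F q ∂(γ.prod γ) := by
    intro t
    rw [← lintegral_map hFc.measurable (by fun_prop),
      IsGaussian.map_rotation_eq_self_of_forall_strongDual_eq_zero
        integral_strongDual_stdGaussian t]
  have hFint : ∫⁻ q, F q ∂(γ.prod γ) =
      ∫⁻ x, ENNReal.ofReal (Real.exp (l ^ 2 * Real.pi ^ 2 / 2 * ‖P x‖ ^ 2)) ∂γ := by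
    rw [lintegral_prod _ hFc.aemeasurable]
    refine lintegral_congr fun x => ?_
    have := lintegral_exp_inner_stdGaussian ((l * Real.pi) • P x)
    simp only [real_inner_smul_left, norm_smul, mul_pow, Real.norm_eq_abs, sq_abs] at this
    simp only [hF]
    rw [this]
    congr 2
    ring
  calc _ = ∫⁻ p, ENNReal.ofReal (Real.exp (l * (‖P p.2‖ ^ 2 - ‖P p.1‖ ^ 2))) ∂(γ.prod γ) := by
        rw [mul_comm, ← lintegral_prod_mul (by fun_prop) (by fun_prop)]
        refine lintegral_congr fun p => ?_
        rw [← ENNReal.ofReal_mul (Real.exp_pos _).le, ← Real.exp_add]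
        congr 2
        ring
    _ ≤ ∫⁻ p, ENNReal.ofReal (2 / Real.pi) * (∫⁻ t in Set.Ioc 0 (Real.pi / 2),
          F (ContinuousLinearMap.rotation t p)) ∂(γ.prod γ) :=
        lintegral_mono fun p => hP.exp_norm_sq_sub_le l p.1 p.2
    _ = ENNReal.ofReal (2 / Real.pi) * ∫⁻ t in Set.Ioc 0 (Real.pi / 2),
          ∫⁻ p, F (ContinuousLinearMap.rotation t p) ∂(γ.prod γ) := by
        have hjc : Continuous fun q : (E × E) × ℝ =>
            F (ContinuousLinearMap.rotation q.2 q.1) := by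
          apply hFc.comp
          simp only [ContinuousLinearMap.rotation_apply]
          fun_prop
        rw [lintegral_const_mul _ hjc.measurable.lintegral_prod_right',
          lintegral_lintegral_swap hjc.measurable.aemeasurable]
    _ = _ := by
        simp only [hrot, hFint, lintegral_const, Measure.restrict_apply_univ, Real.volume_Ioc,
          sub_zero]
        rw [mul_left_comm, ← ENNReal.ofReal_mul (by positivity)]
        rw [show 2 / Real.pi * (Real.pi / 2) = 1 by field_simp]
        simp

end IsConeProjection
theorem integrable_exp_mul_sq_gaussianReal {l : ℝ} (hl : l < 1 / 2) :
    Integrable (fun s => Real.exp (l * s ^ 2)) (gaussianReal 0 1) := by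
  rw [gaussianReal_of_var_ne_zero 0 one_ne_zero,
    integrable_withDensity_iff_integrable_smul' (measurable_gaussianPDF 0 1)
      (Filter.Eventually.of_forall fun _ => gaussianPDF_lt_top)]
  simp only [toReal_gaussianPDF, smul_eq_mul, gaussianPDFReal]
  have h := (integrable_exp_neg_mul_sq (b := 1 / 2 - l) (by linarith)).const_mul
    (√(2 * Real.pi))⁻¹
  refine h.congr (Filter.Eventually.of_forall fun s => ?_)
  simp only [NNReal.coe_one, mul_one, sub_zero, mul_assoc, ← Real.exp_add]
  congr 2
  ring

theorem integrable_exp_mul_norm_sq_stdGaussian {l : ℝ} (hl : l < 1 / 2) :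
    Integrable (fun x => Real.exp (l * ‖x‖ ^ 2)) (stdGaussian E) := by
  rw [stdGaussian, integrable_map_measure (by fun_prop) (Measurable.aemeasurable (by fun_prop))]
  have h := Integrable.fintype_prod (μ := fun _ : Fin (Module.finrank ℝ E) => gaussianReal 0 1)
    (f := fun _ s => Real.exp (l * s ^ 2)) fun _ => integrable_exp_mul_sq_gaussianReal hl
  refine h.congr (Filter.Eventually.of_forall fun x => ?_)
  simp only [Function.comp_apply, ← Real.exp_sum, ← Finset.mul_sum]
  congr 2
  have := (stdOrthonormalBasis ℝ E).sum_sq_norm_inner_right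
    (∑ i, x i • stdOrthonormalBasis ℝ E i)
  simp only [(stdOrthonormalBasis ℝ E).orthonormal.inner_right_fintype, Real.norm_eq_abs,
    sq_abs] at this
  exact this

namespace IsConeProjection

variable {P : E → E} (hP : IsConeProjection P)
include hP

theorem integrable_exp_mul_norm_sq {l : ℝ} (hl : l < 1 / 2) :
    Integrable (fun x => Real.exp (l * ‖P x‖ ^ 2)) (stdGaussian E) := by
  have hPc := hP.continuous
  refine Integrable.mono' ((integrable_const (1 : ℝ)).add
    (integrable_exp_mul_norm_sq_stdGaussian hl))
    (Continuous.aestronglyMeasurable (by fun_prop)) (Filter.Eventually.of_forall fun x => ?_)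
  rw [Real.norm_eq_abs, Real.abs_exp]
  have h := pow_le_pow_left₀ (norm_nonneg _) (hP.norm_le x) 2
  simp only [Pi.add_apply]
  rcases le_total 0 l with h0 | h0
  · have := Real.exp_le_exp.2 (mul_le_mul_of_nonneg_left h h0)
    linarith
  · have := Real.exp_le_one_iff.2 (mul_nonpos_of_nonpos_of_nonneg h0 (sq_nonneg ‖P x‖))
    linarith [Real.exp_pos (l * ‖x‖ ^ 2)]

theorem integrable_norm_sq : Integrable (fun x => ‖P x‖ ^ 2) (stdGaussian E) := by
  have hPc := hP.continuous
  refine Integrable.mono' ((hP.integrable_exp_mul_norm_sq (l := 1 / 4) (by norm_num)).const_mul 4)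
    (Continuous.aestronglyMeasurable (by fun_prop)) (Filter.Eventually.of_forall fun x => ?_)
  rw [Real.norm_eq_abs, abs_of_nonneg (sq_nonneg _)]
  linarith [Real.add_one_le_exp (1 / 4 * ‖P x‖ ^ 2)]

/-- Exponential moments of `‖P ·‖²` in terms of its mean. With `a = l π² / 2` and
`M = 𝔼 exp (l ‖P ·‖²)`, symmetrization and two applications of Jensen's inequality give
`M exp (-l m) ≤ 𝔼 exp (a l ‖P ·‖²) ≤ M ^ a`, which can be solved for `M` when `a < 1`. -/
theorem lintegral_exp_norm_sq_le {l m : ℝ} (hl : 0 < l) (ha : l * Real.pi ^ 2 / 2 < 1)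
    (hm : ∫ x, ‖P x‖ ^ 2 ∂(stdGaussian E) ≤ m) :
    ∫⁻ x, ENNReal.ofReal (Real.exp (l * ‖P x‖ ^ 2)) ∂(stdGaussian E) ≤
      ENNReal.ofReal (Real.exp (l * m / (1 - l * Real.pi ^ 2 / 2))) := by
  have hPc := hP.continuous
  have hl2 : l < 1 / 2 := by nlinarith [Real.pi_gt_three]
  set γ := stdGaussian E
  set a : ℝ := l * Real.pi ^ 2 / 2 with ha_def
  have ha0 : 0 < a := by positivity
  have hal : l * a < 1 / 2 := by nlinarith
  have i1 := hP.integrable_exp_mul_norm_sq hl2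
  have i2 := hP.integrable_exp_mul_norm_sq (l := -l) (by linarith)
  have i3 := hP.integrable_exp_mul_norm_sq hal
  have key := hP.lintegral_exp_norm_sq_mul_le l
  have hla : l ^ 2 * Real.pi ^ 2 / 2 = l * a := by rw [ha_def]; ring
  rw [hla, ← ofReal_integral_eq_lintegral_ofReal i1 (.of_forall fun _ => (Real.exp_pos _).le),
    ← ofReal_integral_eq_lintegral_ofReal i2 (.of_forall fun _ => (Real.exp_pos _).le),
    ← ofReal_integral_eq_lintegral_ofReal i3 (.of_forall fun _ => (Real.exp_pos _).le),
    ← ENNReal.ofReal_mul (integral_nonneg fun _ => (Real.exp_pos _).le),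
    ENNReal.ofReal_le_ofReal_iff (integral_nonneg fun _ => (Real.exp_pos _).le)] at key
  rw [← ofReal_integral_eq_lintegral_ofReal i1 (.of_forall fun _ => (Real.exp_pos _).le)]
  apply ENNReal.ofReal_le_ofReal
  have j1 : Real.exp (-l * ∫ x, ‖P x‖ ^ 2 ∂γ) ≤ ∫ x, Real.exp (-l * ‖P x‖ ^ 2) ∂γ := by
    rw [← integral_const_mul]
    exact convexOn_exp.map_integral_le Real.continuous_exp.continuousOn isClosed_univ (by simp)
      (hP.integrable_norm_sq.const_mul _) i2
  have j2 : ∫ x, Real.exp (l * a * ‖P x‖ ^ 2) ∂γ ≤ (∫ x, Real.exp (l * ‖P x‖ ^ 2) ∂γ) ^ a := by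
    have e : ∀ x, Real.exp (l * a * ‖P x‖ ^ 2) = Real.exp (l * ‖P x‖ ^ 2) ^ a := fun x => by
      rw [← Real.exp_mul]
      congr 1
      ring
    simp only [e] at i3 ⊢
    exact (Real.concaveOn_rpow ha0.le ha.le).le_map_integral
      (Real.continuous_rpow_const ha0.le).continuousOn isClosed_Ici
      (.of_forall fun _ => (Real.exp_pos _).le) i1 i3
  set M := ∫ x, Real.exp (l * ‖P x‖ ^ 2) ∂γ
  have hM : 0 < M := integral_exp_pos i1
  have h4 : M * Real.exp (-l * ∫ x, ‖P x‖ ^ 2 ∂γ) ≤ M ^ a :=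
    (mul_le_mul_of_nonneg_left j1 hM.le).trans (key.trans j2)
  have h5 := Real.log_le_log (by positivity) h4
  rw [Real.log_mul hM.ne' (Real.exp_pos _).ne', Real.log_exp, Real.log_rpow hM] at h5
  rw [← Real.log_le_iff_le_exp hM, le_div_iff₀ (by linarith)]
  have := mul_le_mul_of_nonneg_left hm hl.le
  linarith

theorem measure_norm_sq_gt_le {l m : ℝ} (hl : 0 < l) (ha : l * Real.pi ^ 2 / 2 < 1)
    (hm : ∫ x, ‖P x‖ ^ 2 ∂(stdGaussian E) ≤ m) (t : ℝ) :
    stdGaussian E {x | t < ‖P x‖ ^ 2} ≤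
      ENNReal.ofReal (Real.exp (l * m / (1 - l * Real.pi ^ 2 / 2) - l * t)) := by
  have hPc := hP.continuous
  have hsub : {x | t < ‖P x‖ ^ 2} ⊆ {x | ENNReal.ofReal (Real.exp (l * t)) ≤
      ENNReal.ofReal (Real.exp (l * ‖P x‖ ^ 2))} := fun x hx =>
    ENNReal.ofReal_le_ofReal (Real.exp_le_exp.2 (mul_le_mul_of_nonneg_left (le_of_lt hx) hl.le))
  refine (measure_mono hsub).trans ((meas_ge_le_lintegral_div (by fun_prop) (by simp [Real.exp_pos])
    ENNReal.ofReal_ne_top).trans ?_)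
  rw [Real.exp_sub, ENNReal.ofReal_div_of_pos (Real.exp_pos _)]
  gcongr
  exact hP.lintegral_exp_norm_sq_le hl ha hm

end IsConeProjection
end Gaussian

/-! ### Existence of cone projections -/

section Existence
variable {E : Type*} [NormedAddCommGroup E] [InnerProductSpace ℝ E] 

/-- The metric projection onto a closed convex cone of a Hilbert space, with its variational
characterization. -/
theorem exists_isConeProjection [CompleteSpace E] {K : Set E} (hc : IsClosed K)
    (hK : Convex ℝ K) (h0 : (0 : E) ∈ K) (hsmul : ∀ c : ℝ, 0 ≤ c → ∀ x ∈ K, c • x ∈ K) :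
    ∃ P : E → E, IsConeProjection P ∧ ∀ x, P x ∈ K ∧ ∀ y ∈ K, inner ℝ x y ≤ inner ℝ (P x) y := by
  have hex : ∀ x : E, ∃ p ∈ K, inner ℝ x p = ‖p‖ ^ 2 ∧ ∀ y ∈ K, inner ℝ x y ≤ inner ℝ p y := by
    intro x
    obtain ⟨p, hp, hmin⟩ := exists_norm_eq_iInf_of_complete_convex ⟨0, h0⟩ hc.isComplete hK x
    have hvar := (norm_eq_iInf_iff_real_inner_le_zero hK hp).1 hmin
    have h1 := hvar 0 h0
    have h2 := hvar _ (hsmul 2 (by norm_num) p hp)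
    rw [two_smul, add_sub_cancel_right] at h2
    rw [zero_sub, inner_neg_right] at h1
    have h3 : inner ℝ (x - p) p = 0 := by linarith
    refine ⟨p, hp, ?_, fun y hy => ?_⟩
    · rw [inner_sub_left, real_inner_self_eq_norm_sq] at h3
      linarith
    · have hmid := hK hy hp (a := 1 / 2) (b := 1 / 2) (by norm_num) (by norm_num) (by norm_num)
      -- The variational inequality at `y + p`, which is twice the midpoint of `y` and `p`.
      have h4 := hvar _ (hsmul 2 (by norm_num) _ hmid)
      rw [smul_add, smul_smul, smul_smul] at h4
      norm_num at h4
      rw [inner_sub_left] at h4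
      linarith
  choose P hPK hP1 hP2 using hex
  exact ⟨P, ⟨hP1, fun x y => hP2 x _ (hPK y)⟩, fun x => ⟨hPK x, hP2 x⟩⟩

end Existence

/-! ### A maximal inequality by reflection -/

section Reflection
variable {E : Type*} [NormedAddCommGroup E] [InnerProductSpace ℝ E] [FiniteDimensional ℝ E]
  [MeasurableSpace E] [BorelSpace E]

theorem lintegral_comp_isometry_stdGaussian (f : E ≃ₗᵢ[ℝ] E) (g : E → ℝ≥0∞) (hg : Measurable g) :
    ∫⁻ x, g (f x) ∂(stdGaussian E) = ∫⁻ x, g x ∂(stdGaussian E) := by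
  conv_rhs => rw [← stdGaussian_map f]
  rw [lintegral_map hg (by fun_prop)]

variable {ι κ : Type*} [LinearOrder κ] {r : ι → κ} (hr : Function.Injective r) {s : Finset ι}
  {v : ι → E} {w : E} (h : ∀ j ∈ s, ∀ k ∈ s, r j ≤ r k → inner ℝ (w - v j) (v k) = 0)
include hr h

/-- A maximal inequality of Lévy type, for vectors such that `w - v j` is orthogonal to `v k`
whenever `k` is not before `j`. On the event that `j` is the last index with `⟪v j, x⟫ > t`, the
reflection in the hyperplane orthogonal to `w - v j` preserves the event and the Gaussian measure
and sends `⟪w, x⟫` to `2 ⟪v j, x⟫ - ⟪w, x⟫`, so one of these two numbers exceeds `t`. -/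
theorem measure_exists_lt_inner_le (t : ℝ) :
    stdGaussian E {x | ∃ j ∈ s, t < inner ℝ (v j) x} ≤
      2 * stdGaussian E {x | t < inner ℝ w x} := by
  set γ := stdGaussian E
  set G : Set E := {x | t < inner ℝ w x}
  set F : ι → Set E := fun j =>
    {x | t < inner ℝ (v j) x} ∩ ⋂ k ∈ s, ⋂ _ : r j < r k, {x | inner ℝ (v k) x ≤ t} with hF
  have hFm : ∀ j, MeasurableSet (F j) := fun j => by
    refine (measurableSet_lt (by fun_prop) (by fun_prop)).inter ?_
    exact Finset.measurableSet_biInter _ fun k _ => MeasurableSet.iInter fun _ =>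
      measurableSet_le (by fun_prop) (by fun_prop)
  have hGm : MeasurableSet G := measurableSet_lt (by fun_prop) (by fun_prop)
  have hmemF : ∀ j x, x ∈ F j ↔ t < inner ℝ (v j) x ∧
      ∀ k ∈ s, r j < r k → inner ℝ (v k) x ≤ t := fun j x => by
    simp [hF]
  have hcover : {x | ∃ j ∈ s, t < inner ℝ (v j) x} ⊆ ⋃ j ∈ s, F j := by
    rintro x ⟨j, hj, hjx⟩
    obtain ⟨m, hm, hmax⟩ := Finset.exists_max_image (s.filter fun j => t < inner ℝ (v j) x) r
      ⟨j, by simp [hj, hjx]⟩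
    rw [Finset.mem_filter] at hm
    simp only [Set.mem_iUnion]
    refine ⟨m, hm.1, (hmemF m x).2 ⟨hm.2, fun k hk hmk => ?_⟩⟩
    by_contra! hlt
    exact absurd (hmax k (by simp [hk, hlt])) (not_le.2 hmk)
  have hrefl : ∀ j ∈ s, γ (F j) ≤ 2 * γ (F j ∩ G) := by
    intro j hj
    set T := (Submodule.span ℝ {w - v j})ᗮ.reflection
    have hTv : ∀ k ∈ s, r j ≤ r k → T (v k) = v k := fun k hk hjk =>
      Submodule.reflection_eq_self_iff _ |>.2
        (Submodule.mem_orthogonal_singleton_iff_inner_right.2 (h j hj k hk hjk))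
    have hTw : T w = 2 • v j - w := by
      have h1 : T (w - v j) = -(w - v j) := Submodule.reflection_orthogonalComplement_singleton_eq_neg _
      rw [map_sub, hTv j hj le_rfl] at h1
      rw [sub_eq_iff_eq_add.1 h1]
      module
    have hTin : ∀ a x, inner ℝ a (T x) = inner ℝ (T a) x := fun a x => by
      rw [← T.inner_map_map (T a) x]
      simp [T]
    have hsub : F j ⊆ (F j ∩ G) ∪ T ⁻¹' (F j ∩ G) := by
      intro x hx
      by_cases hxG : x ∈ G
      · exact Or.inl ⟨hx, hxG⟩
      · right
        have hx' := (hmemF j x).1 hx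
        refine ⟨(hmemF j _).2 ⟨?_, fun k hk hjk => ?_⟩, ?_⟩
        · rw [hTin, hTv j hj le_rfl]
          exact hx'.1
        · rw [hTin, hTv k hk hjk.le]
          exact hx'.2 k hk hjk
        · have h2 : inner ℝ w x ≤ t := not_lt.1 hxG
          change t < inner ℝ w (T x)
          rw [hTin, hTw, two_smul, inner_sub_left, inner_add_left]
          linarith [hx'.1]
    calc γ (F j) ≤ γ (F j ∩ G) + γ (T ⁻¹' (F j ∩ G)) :=
          (measure_mono hsub).trans (measure_union_le _ _)
      _ = γ (F j ∩ G) + γ (F j ∩ G) := by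
          rw [← Measure.map_apply (by fun_prop) ((hFm j).inter hGm), stdGaussian_map]
      _ = _ := (two_mul _).symm
  calc γ {x | ∃ j ∈ s, t < inner ℝ (v j) x} ≤ γ (⋃ j ∈ s, F j) := measure_mono hcover
    _ ≤ ∑ j ∈ s, γ (F j) := measure_biUnion_finset_le _ _
    _ ≤ ∑ j ∈ s, 2 * γ (F j ∩ G) := Finset.sum_le_sum hrefl
    _ = 2 * γ (⋃ j ∈ s, (F j ∩ G)) := by
        rw [← Finset.mul_sum, measure_biUnion_finset _ fun j _ => (hFm j).inter hGm]
        intro j hj k hk hjk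
        refine Set.disjoint_left.2 fun x hxj hxk => ?_
        have hxj' := (hmemF j x).1 hxj.1
        have hxk' := (hmemF k x).1 hxk.1
        rcases lt_or_gt_of_ne (hr.ne hjk) with hlt | hlt
        · exact absurd (hxj'.2 k hk hlt) (not_le.2 hxk'.1)
        · exact absurd (hxk'.2 j hj hlt) (not_le.2 hxj'.1)
    _ ≤ 2 * γ G := by
        gcongr
        exact Set.iUnion₂_subset fun _ _ => Set.inter_subset_right

/-- The second moment of the positive part of the maximum, by the layer-cake formula from the
maximal inequality; the factor `2` there is absorbed because `⟪w, x⟫` is symmetric. -/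
theorem lintegral_sup_inner_sq_le :
    ∫⁻ x, ENNReal.ofReal (((s.sup fun j => (inner ℝ (v j) x).toNNReal : NNReal) : ℝ) ^ 2)
      ∂(stdGaussian E) ≤ ENNReal.ofReal (‖w‖ ^ 2) := by
  set γ := stdGaussian E
  have hlayer : ∀ f : E → NNReal, Measurable f → ∫⁻ x, ENNReal.ofReal ((f x : ℝ) ^ 2) ∂γ =
      ENNReal.ofReal 2 * ∫⁻ t in Set.Ioi (0 : ℝ), γ {x | t < f x} * ENNReal.ofReal t := by
    intro f hf
    have := lintegral_rpow_eq_lintegral_meas_lt_mul γ (f := fun x => (f x : ℝ))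
      (.of_forall fun x => (f x).2) (by fun_prop) (p := 2) (by norm_num)
    simp only [Real.rpow_two] at this
    rw [this]
    norm_num
  have hm : Measurable fun x => s.sup fun j => (inner ℝ (v j) x).toNNReal := by
    exact (Continuous.finset_sup_apply fun j _ => by fun_prop).measurable
  have hw : ∫⁻ x, ENNReal.ofReal (((inner ℝ w x).toNNReal : ℝ) ^ 2) ∂γ +
      ∫⁻ x, ENNReal.ofReal (((inner ℝ w x).toNNReal : ℝ) ^ 2) ∂γ = ENNReal.ofReal (‖w‖ ^ 2) := by
    have hneg := lintegral_comp_isometry_stdGaussian (LinearIsometryEquiv.neg ℝ (E := E))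
      (fun x => ENNReal.ofReal (((inner ℝ w x).toNNReal : ℝ) ^ 2)) (by fun_prop)
    conv_lhs => enter [1]; rw [← hneg]
    rw [← lintegral_add_left (by fun_prop), ← lintegral_inner_sq_stdGaussian]
    refine lintegral_congr fun x => ?_
    rw [← ENNReal.ofReal_add (by positivity) (by positivity)]
    congr 1
    simp only [LinearIsometryEquiv.coe_neg, inner_neg_right, Real.coe_toNNReal']
    rcases le_total 0 (inner ℝ w x) with h0 | h0
    · rw [max_eq_right (by linarith), max_eq_left h0]; ring
    · rw [max_eq_left (by linarith), max_eq_right h0]; ring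
  -- Compare the two layer-cake integrals level by level.
  rw [hlayer _ hm, ← hw, ← two_mul, hlayer _ (by fun_prop), mul_left_comm]
  gcongr ENNReal.ofReal 2 * ?_
  rw [← lintegral_const_mul' _ _ (by simp)]
  refine setLIntegral_mono' measurableSet_Ioi fun t ht => ?_
  rw [← mul_assoc]
  gcongr
  have ht' : (0 : ℝ) ≤ t := le_of_lt ht
  lift t to NNReal using ht'
  simp only [NNReal.coe_lt_coe, Finset.lt_sup_iff]
  simpa [Real.lt_toNNReal_iff_coe_lt] using measure_exists_lt_inner_le hr h t

end Reflection

/-! ### Summation over initial segments -/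

section Averages

variable {ι κ : Type*} [LinearOrder κ]

theorem filter_insert_le_of_lt {r : ι → κ} [DecidableEq ι] {s : Finset ι} {a i : ι} (h : r i < r a) :
    (insert a s).filter (r · ≤ r i) = s.filter (r · ≤ r i) := by
  rw [Finset.filter_insert, if_neg (not_le.2 h)]

theorem filter_insert_le_self {r : ι → κ} [DecidableEq ι] {s : Finset ι} {a : ι}
    (h : ∀ x ∈ s, r x ≤ r a) : (insert a s).filter (r · ≤ r a) = insert a s := by
  rw [Finset.filter_eq_self]
  intro x hx
  rcases Finset.mem_insert.1 hx with rfl | hx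
  · exact le_rfl
  · exact h x hx

variable {r : ι → κ} (hr : Function.Injective r)
include hr

/-- Abel summation as an inequality: if all sums of `z` over initial segments are nonpositive and
`f` is nonincreasing with lower bound `M ≥ 0`, then `∑ f z ≤ M ∑ z`. -/
theorem sum_mul_le_of_sum_filter_nonpos (z f : ι → ℝ) (s : Finset ι)
    (hf : ∀ i ∈ s, ∀ j ∈ s, r i ≤ r j → f j ≤ f i)
    (hz : ∀ i ∈ s, ∑ j ∈ s with r j ≤ r i, z j ≤ 0) (M : ℝ) (hM : 0 ≤ M)
    (hMf : ∀ i ∈ s, M ≤ f i) : ∑ i ∈ s, f i * z i ≤ M * ∑ i ∈ s, z i := by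
  classical
  induction s using Finset.induction_on_max_value r generalizing M with
  | empty => simp
  | insert a s ha hmax ih =>
    have hlt : ∀ i ∈ s, r i < r a := fun i hi =>
      lt_of_le_of_ne (hmax i hi) (hr.ne (ne_of_mem_of_not_mem hi ha))
    have hfa := hMf a (Finset.mem_insert_self _ _)
    have h1 := ih (fun i hi j hj => hf i (Finset.mem_insert_of_mem hi) j (Finset.mem_insert_of_mem hj))
      (fun i hi => by
        rw [← filter_insert_le_of_lt (hlt i hi)]
        exact hz i (Finset.mem_insert_of_mem hi)) (f a) (hM.trans hfa)
      (fun i hi => hf i (Finset.mem_insert_of_mem hi) a (Finset.mem_insert_self _ _) (hmax i hi))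
    have h2 := hz a (Finset.mem_insert_self _ _)
    rw [filter_insert_le_self hmax] at h2
    have h3 := mul_le_mul_of_nonpos_right hfa h2
    rw [Finset.sum_insert ha] at h3
    rw [Finset.sum_insert ha, Finset.sum_insert ha]
    linarith

theorem sum_inv_card_filter_le (s : Finset ι) :
    ∑ i ∈ s, (1 : ℝ) / (s.filter (r · ≤ r i)).card = harmonic s.card := by
  classical
  induction s using Finset.induction_on_max_value r with
  | empty => simp
  | insert a s ha hmax ih =>
    have hlt : ∀ i ∈ s, r i < r a := fun i hi =>
      lt_of_le_of_ne (hmax i hi) (hr.ne (ne_of_mem_of_not_mem hi ha))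
    rw [Finset.sum_insert ha, filter_insert_le_self hmax, Finset.card_insert_of_notMem ha,
      harmonic_succ, Finset.sum_congr rfl fun i hi => by rw [filter_insert_le_of_lt (hlt i hi)], ih]
    push_cast
    rw [one_div, add_comm]

end Averages

/-! ### Maximal averages over initial segments -/

section InitialAverages
variable {ι κ : Type*} [LinearOrder κ] [Fintype ι]

/-- The vector whose inner product with `x` is the average of `x` over the initial segment
`{j ∈ s | r j ≤ r i}`. The injection `r` orders the indices; taking it to be the identity or
`OrderDual.toDual` treats initial and final segments alike. -/
noncomputable def initialAverage (r : ι → κ) (s : Finset ι) (i : ι) : EuclideanSpace ℝ ι :=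
  WithLp.toLp 2 (Set.indicator (s.filter (r · ≤ r i)) fun _ => 1 / ((s.filter (r · ≤ r i)).card : ℝ))

/-- The maximal average of `x` over the initial segments of `s` that contain `i`, or `0` if all of
them are negative. -/
noncomputable def maxAverage (r : ι → κ) (s : Finset ι) (i : ι) (x : EuclideanSpace ℝ ι) : NNReal :=
  (s.filter (r i ≤ r ·)).sup fun c => (inner ℝ (initialAverage r s c) x).toNNReal

theorem inner_initialAverage (r : ι → κ) (s : Finset ι) (i : ι) (x : EuclideanSpace ℝ ι) :
    inner ℝ (initialAverage r s i) x =
      1 / ((s.filter (r · ≤ r i)).card : ℝ) * ∑ j ∈ s with r j ≤ r i, x j := by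
  classical
  simp only [PiLp.inner_apply, initialAverage, RCLike.inner_apply, conj_trivial,
    Set.indicator_apply, Finset.mem_coe, mul_ite, mul_zero]
  rw [← Finset.sum_filter, Finset.filter_mem_eq_inter, Finset.univ_inter, ← Finset.sum_mul, mul_comm]

theorem inner_initialAverage_initialAverage (r : ι → κ) (s : Finset ι) {i k : ι} (hi : i ∈ s)
    (hik : r i ≤ r k) : inner ℝ (initialAverage r s i) (initialAverage r s k) =
      1 / ((s.filter (r · ≤ r k)).card : ℝ) := by
  classical
  rw [inner_initialAverage]
  have : ∀ j ∈ s.filter (r · ≤ r i), initialAverage r s k j =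
      1 / ((s.filter (r · ≤ r k)).card : ℝ) := by
    intro j hj
    rw [Finset.mem_filter] at hj
    simp only [initialAverage]
    rw [Set.indicator_of_mem]
    simp [hj.1, hj.2.trans hik]
  rw [Finset.sum_congr rfl this, Finset.sum_const, nsmul_eq_mul, ← mul_assoc, one_div_mul_cancel,
    one_mul]
  exact_mod_cast (Finset.card_pos.2 ⟨i, by simp [hi]⟩).ne'

variable {r : ι → κ} (hr : Function.Injective r) {s : Finset ι}
include hr

/-- The averages over the initial segments ending at or after `i` form a reversed martingale with
orthogonal increments, so the Lévy-type inequality applies and the second moment is at most that of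
the average over the shortest of these segments. -/
theorem lintegral_maxAverage_sq_le {i : ι} (hi : i ∈ s) :
    ∫⁻ x, ENNReal.ofReal ((maxAverage r s i x : ℝ) ^ 2) ∂(stdGaussian (EuclideanSpace ℝ ι)) ≤
      ENNReal.ofReal (1 / (s.filter (r · ≤ r i)).card) := by
  have h := lintegral_sup_inner_sq_le hr (s := s.filter (r i ≤ r ·)) (v := initialAverage r s)
    (w := initialAverage r s i) fun j hj k hk hjk => by
      rw [Finset.mem_filter] at hj
      rw [inner_sub_left, inner_initialAverage_initialAverage r s hi (hj.2.trans hjk),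
        inner_initialAverage_initialAverage r s hj.1 hjk, sub_self]
  rwa [← real_inner_self_eq_norm_sq, inner_initialAverage_initialAverage r s hi le_rfl] at h

/-- Against nonnegative nonincreasing weights, `x` may be replaced by its maximal averages, since
these have larger sums over every initial segment. -/
theorem sum_mul_le_sum_mul_maxAverage (x : EuclideanSpace ℝ ι) (f : ι → ℝ)
    (hf : ∀ i ∈ s, ∀ j ∈ s, r i ≤ r j → f j ≤ f i) (hf0 : ∀ i ∈ s, 0 ≤ f i) :
    ∑ i ∈ s, f i * x i ≤ ∑ i ∈ s, f i * maxAverage r s i x := by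
  have h := sum_mul_le_of_sum_filter_nonpos hr (fun i => x i - maxAverage r s i x) f s hf ?_ 0
    le_rfl hf0
  · simp only [mul_sub, Finset.sum_sub_distrib, zero_mul] at h
    linarith
  · intro i hi
    have hcard : (0 : ℝ) < (s.filter (r · ≤ r i)).card := by
      exact_mod_cast Finset.card_pos.2 ⟨i, by simp [hi]⟩
    have h1 : ∀ j ∈ s.filter (r · ≤ r i),
        inner ℝ (initialAverage r s i) x ≤ maxAverage r s j x := by
      intro j hj
      rw [Finset.mem_filter] at hj
      refine (Real.le_coe_toNNReal _).trans (NNReal.coe_le_coe.2 ?_)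
      exact Finset.le_sup (f := fun c => (inner ℝ (initialAverage r s c) x).toNNReal)
        (by simp [hi, hj.2])
    have h2 := Finset.card_nsmul_le_sum _ _ _ h1
    rw [inner_initialAverage, nsmul_eq_mul, ← mul_assoc, mul_one_div_cancel hcard.ne',
      one_mul] at h2
    rw [Finset.sum_sub_distrib]
    linarith

omit hr in
theorem measurable_maxAverage (i : ι) : Measurable (maxAverage r s i) :=
  (Continuous.finset_sup_apply fun j _ => by fun_prop).measurable

theorem sum_lintegral_maxAverage_sq_le (s : Finset ι) :
    ∑ i ∈ s, ∫⁻ x, ENNReal.ofReal ((maxAverage r s i x : ℝ) ^ 2)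
      ∂(stdGaussian (EuclideanSpace ℝ ι)) ≤ ENNReal.ofReal (1 + Real.log s.card) := by
  refine (Finset.sum_le_sum fun i hi => lintegral_maxAverage_sq_le hr hi).trans ?_
  rw [← ENNReal.ofReal_sum_of_nonneg fun _ _ => by positivity]
  refine ENNReal.ofReal_le_ofReal ?_
  rw [sum_inv_card_filter_le hr]
  exact harmonic_le_one_add_log _

end InitialAverages

/-! ### Nonincreasing sequences on an interval -/

section AntitoneCone
variable {ι : Type*} [LinearOrder ι]

/-- The cone of vectors that vanish outside `s` and are nonincreasing on `s`. -/
def antitoneCone (s : Finset ι) : Set (EuclideanSpace ℝ ι) :=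
  {u | (∀ i ∉ s, u i = 0) ∧ ∀ i ∈ s, ∀ j ∈ s, i ≤ j → u j ≤ u i}

variable [Fintype ι]

theorem exists_isConeProjection_antitoneCone (s : Finset ι) :
    ∃ P : EuclideanSpace ℝ ι → EuclideanSpace ℝ ι, IsConeProjection P ∧
      ∀ x, P x ∈ antitoneCone s ∧ ∀ y ∈ antitoneCone s, inner ℝ x y ≤ inner ℝ (P x) y := by
  apply exists_isConeProjection
  · have : antitoneCone s = (⋂ i ∈ (s : Set ι)ᶜ, {u : EuclideanSpace ℝ ι | u i = 0}) ∩
        ⋂ i ∈ s, ⋂ j ∈ s, ⋂ _ : i ≤ j, {u : EuclideanSpace ℝ ι | u j ≤ u i} := by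
      ext u
      simp [antitoneCone]
    rw [this]
    refine IsClosed.inter (isClosed_biInter fun i _ => ?_) (isClosed_biInter fun i _ =>
      isClosed_biInter fun j _ => isClosed_iInter fun _ => ?_)
    · exact isClosed_eq (by fun_prop) (by fun_prop)
    · exact isClosed_le (by fun_prop) (by fun_prop)
  · intro u hu v hv a b ha hb _
    refine ⟨fun i hi => by simp [hu.1 i hi, hv.1 i hi], fun i hi j hj hij => ?_⟩
    have h1 := mul_le_mul_of_nonneg_left (hu.2 i hi j hj hij) ha
    have h2 := mul_le_mul_of_nonneg_left (hv.2 i hi j hj hij) hb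
    simpa using add_le_add h1 h2
  · exact ⟨by simp, by simp⟩
  · intro c hc u hu
    refine ⟨fun i hi => by simp [hu.1 i hi], fun i hi j hj hij => ?_⟩
    simpa using mul_le_mul_of_nonneg_left (hu.2 i hi j hj hij) hc

/-- The positive part of `u` is nonincreasing for the order of `ι` and the negative part for the
reversed order; each is tested against the maximal averages for its order, and the square is
completed coordinatewise. -/
theorem two_mul_inner_sub_norm_sq_le {s : Finset ι} (x : EuclideanSpace ℝ ι)
    {u : EuclideanSpace ℝ ι} (hu : u ∈ antitoneCone s) :
    2 * inner ℝ x u - ‖u‖ ^ 2 ≤ ∑ i ∈ s, ((maxAverage id s i x : ℝ) ^ 2 +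
      (maxAverage OrderDual.toDual s i (-x) : ℝ) ^ 2) := by
  have e1 : inner ℝ x u = ∑ i ∈ s, u i * x i := by
    rw [PiLp.inner_apply]
    simp only [RCLike.inner_apply, conj_trivial]
    exact (Finset.sum_subset (Finset.subset_univ s) fun i _ hi => by rw [hu.1 i hi, zero_mul]).symm
  have e2 : ‖u‖ ^ 2 = ∑ i ∈ s, u i ^ 2 := by
    rw [EuclideanSpace.real_norm_sq_eq]
    exact (Finset.sum_subset (Finset.subset_univ s) fun i _ hi => by
      rw [hu.1 i hi]; simp).symm
  have h1 := sum_mul_le_sum_mul_maxAverage (r := id) Function.injective_id (s := s) x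
    (fun i => max (u i) 0)
    (fun i hi j hj hij => max_le_max (hu.2 i hi j hj hij) le_rfl) fun i _ => le_max_right _ _
  have h2 := sum_mul_le_sum_mul_maxAverage (r := OrderDual.toDual) OrderDual.toDual.injective
    (s := s) (-x) (fun i => max (-u i) 0)
    (fun i hi j hj hij => max_le_max (neg_le_neg (hu.2 j hj i hi (OrderDual.toDual_le_toDual.1 hij)))
      le_rfl) fun i _ => le_max_right _ _
  have h3 : ∑ i ∈ s, (2 * (u i * x i) - u i ^ 2) = ∑ i ∈ s, (2 * (max (u i) 0 * x i) +
      2 * (max (-u i) 0 * (-x) i) - max (u i) 0 ^ 2 - max (-u i) 0 ^ 2) := by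
    refine Finset.sum_congr rfl fun i _ => ?_
    rcases le_total 0 (u i) with h0 | h0
    · rw [max_eq_left h0, max_eq_right (by linarith)]; simp
    · rw [max_eq_right h0, max_eq_left (by linarith)]; simp
  have h4 : ∑ i ∈ s, (2 * (max (u i) 0 * maxAverage id s i x) +
      2 * (max (-u i) 0 * maxAverage OrderDual.toDual s i (-x)) - max (u i) 0 ^ 2 -
        max (-u i) 0 ^ 2) ≤ ∑ i ∈ s, ((maxAverage id s i x : ℝ) ^ 2 +
      (maxAverage OrderDual.toDual s i (-x) : ℝ) ^ 2) := by
    refine Finset.sum_le_sum fun i _ => ?_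
    nlinarith [sq_nonneg (max (u i) 0 - maxAverage id s i x),
      sq_nonneg (max (-u i) 0 - maxAverage OrderDual.toDual s i (-x))]
  rw [e1, e2, Finset.mul_sum, ← Finset.sum_sub_distrib, h3]
  refine le_trans ?_ h4
  simp only [Finset.sum_sub_distrib, Finset.sum_add_distrib, ← Finset.mul_sum]
  linarith

/-- The statistical dimension of the cone of nonincreasing sequences is logarithmic in their
length. -/
theorem integral_norm_sq_le_log {s : Finset ι} {P : EuclideanSpace ℝ ι → EuclideanSpace ℝ ι}
    (hP : IsConeProjection P) (hPs : ∀ x, P x ∈ antitoneCone s) :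
    ∫ x, ‖P x‖ ^ 2 ∂(stdGaussian (EuclideanSpace ℝ ι)) ≤ 2 * (1 + Real.log s.card) := by
  have hlog : 0 ≤ Real.log s.card := Real.log_natCast_nonneg _
  rw [← ENNReal.ofReal_le_ofReal_iff (by positivity),
    ofReal_integral_eq_lintegral_ofReal hP.integrable_norm_sq (.of_forall fun _ => sq_nonneg _)]
  have hneg := fun i => lintegral_comp_isometry_stdGaussian
    (LinearIsometryEquiv.neg ℝ (E := EuclideanSpace ℝ ι))
      (fun x => ENNReal.ofReal ((maxAverage OrderDual.toDual s i x : ℝ) ^ 2))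
      (by have := measurable_maxAverage (r := OrderDual.toDual) (s := s) i; fun_prop)
  simp only [LinearIsometryEquiv.coe_neg] at hneg
  calc ∫⁻ x, ENNReal.ofReal (‖P x‖ ^ 2) ∂(stdGaussian (EuclideanSpace ℝ ι))
      ≤ ∫⁻ x, ∑ i ∈ s, (ENNReal.ofReal ((maxAverage id s i x : ℝ) ^ 2) +
        ENNReal.ofReal ((maxAverage OrderDual.toDual s i (-x) : ℝ) ^ 2))
          ∂(stdGaussian (EuclideanSpace ℝ ι)) := by
        refine lintegral_mono fun x => ?_
        have h := two_mul_inner_sub_norm_sq_le x (hPs x)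
        rw [hP.inner_self, show 2 * ‖P x‖ ^ 2 - ‖P x‖ ^ 2 = ‖P x‖ ^ 2 by ring] at h
        refine (ENNReal.ofReal_le_ofReal h).trans ?_
        rw [ENNReal.ofReal_sum_of_nonneg fun _ _ => by positivity]
        exact Finset.sum_le_sum fun i _ => ENNReal.ofReal_add_le
    _ = ∑ i ∈ s, ∫⁻ x, ENNReal.ofReal ((maxAverage id s i x : ℝ) ^ 2)
          ∂(stdGaussian (EuclideanSpace ℝ ι)) +
        ∑ i ∈ s, ∫⁻ x, ENNReal.ofReal ((maxAverage OrderDual.toDual s i x : ℝ) ^ 2)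
          ∂(stdGaussian (EuclideanSpace ℝ ι)) := by
        have hm1 := fun i => measurable_maxAverage (r := id) (s := s) i
        have hm2 := fun i => measurable_maxAverage (r := OrderDual.toDual) (s := s) i
        rw [lintegral_finsetSum _ fun i _ => by fun_prop, ← Finset.sum_add_distrib]
        refine Finset.sum_congr rfl fun i _ => ?_
        rw [lintegral_add_left (by fun_prop), ← hneg]
    _ ≤ ENNReal.ofReal (1 + Real.log s.card) + ENNReal.ofReal (1 + Real.log s.card) :=
        add_le_add (sum_lintegral_maxAverage_sq_le Function.injective_id s)
          (sum_lintegral_maxAverage_sq_le OrderDual.toDual.injective s)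
    _ = _ := by rw [← ENNReal.ofReal_add (by positivity) (by positivity), two_mul]

theorem integral_norm_sq_le_card {P : EuclideanSpace ℝ ι → EuclideanSpace ℝ ι}
    (hP : IsConeProjection P) :
    ∫ x, ‖P x‖ ^ 2 ∂(stdGaussian (EuclideanSpace ℝ ι)) ≤ Fintype.card ι := by
  rw [← ENNReal.ofReal_le_ofReal_iff (by positivity),
    ofReal_integral_eq_lintegral_ofReal hP.integrable_norm_sq (.of_forall fun _ => sq_nonneg _)]
  calc ∫⁻ x, ENNReal.ofReal (‖P x‖ ^ 2) ∂(stdGaussian (EuclideanSpace ℝ ι))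
      ≤ ∫⁻ x, ∑ i, ENNReal.ofReal (inner ℝ (EuclideanSpace.basisFun ι ℝ i) x ^ 2)
          ∂(stdGaussian (EuclideanSpace ℝ ι)) := by
        refine lintegral_mono fun x => ?_
        rw [← ENNReal.ofReal_sum_of_nonneg fun _ _ => sq_nonneg _,
          (EuclideanSpace.basisFun ι ℝ).sum_sq_inner_right]
        exact ENNReal.ofReal_le_ofReal (pow_le_pow_left₀ (norm_nonneg _) (hP.norm_le x) 2)
    _ = ENNReal.ofReal (Fintype.card ι) := by
        rw [lintegral_finsetSum _ fun i _ => by fun_prop]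
        simp [lintegral_inner_sq_stdGaussian]

end AntitoneCone

/-! ### The law of the observation -/

section Observation

theorem observationLaw_eq_map {n : ℕ} (μ : EuclideanSpace ℝ (Fin n)) (σ : ℝ) :
    observationLaw μ σ =
      (stdGaussian (EuclideanSpace ℝ (Fin n))).map fun g => μ + σ • g := by
  have h : multivariateGaussian (0 : EuclideanSpace ℝ (Fin n))
      (σ ^ 2 • (1 : Matrix (Fin n) (Fin n) ℝ)) =
        (stdGaussian (EuclideanSpace ℝ (Fin n))).map fun g => σ • g := by
    apply Measure.ext_of_charFun
    ext t
    rw [charFun_multivariateGaussian (Matrix.PosSemidef.one.smul (sq_nonneg σ)), charFun_map_smul,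
      charFun_stdGaussian, norm_smul, ← Complex.ofReal_pow, mul_pow, EuclideanSpace.real_norm_sq_eq]
    have e : t.ofLp ⬝ᵥ (σ ^ 2 • (1 : Matrix (Fin n) (Fin n) ℝ)).mulVec t.ofLp =
        ‖σ‖ ^ 2 * ∑ i, t i ^ 2 := by
      rw [Matrix.smul_mulVec, Matrix.one_mulVec, dotProduct_smul, Real.norm_eq_abs, sq_abs]
      simp [dotProduct, ← sq]
    rw [e, inner_zero_right]
    simp [neg_div]
  rw [observationLaw, h, Measure.map_map (by fun_prop) (by fun_prop)]
  rfl

end Observation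

/-! ### The isotonic least squares estimator -/

section LeastSquares
variable {n : ℕ}

theorem isConeProjection_isotonicLSE :
    IsConeProjection (isotonicLSE (n := n)) ∧
      ∀ y, ∀ u ∈ nondecreasingCone n, inner ℝ y u ≤ inner ℝ (isotonicLSE y) u := by
  obtain ⟨P, hP, hPK⟩ := exists_isConeProjection (K := nondecreasingCone n)
    (by
      have h : nondecreasingCone n =
          ⋂ (i : Fin n) (j : Fin n) (_ : i ≤ j), {u : EuclideanSpace ℝ (Fin n) | u i ≤ u j} := by
        ext u
        simp [nondecreasingCone, Monotone]
      rw [h]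
      refine isClosed_iInter fun i => isClosed_iInter fun j => isClosed_iInter fun _ => ?_
      exact isClosed_le (by fun_prop) (by fun_prop))
    (by
      intro u hu v hv a b ha hb _ i j hij
      simpa using add_le_add (mul_le_mul_of_nonneg_left (hu hij) ha)
        (mul_le_mul_of_nonneg_left (hv hij) hb))
    (fun i j _ => by simp)
    (fun c hc u hu i j hij => by simpa using mul_le_mul_of_nonneg_left (hu hij) hc)
  have heq : isotonicLSE = P := by
    funext y
    refine (existsUnique_isotonicLSE y).unique (isotonicLSE_spec y) ⟨(hPK y).1, fun u hu => ?_⟩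
    rw [scaledNormSq_eq_norm, scaledNormSq_eq_norm]
    refine mul_le_mul_of_nonneg_left ?_ (by positivity)
    rw [norm_sub_sq_real, norm_sub_sq_real, hP.inner_self]
    have h1 := (hPK y).2 u hu
    have h2 := sq_nonneg ‖P y - u‖
    rw [norm_sub_sq_real] at h2
    linarith
  rw [heq]
  exact ⟨hP, fun y => (hPK y).2⟩

/-- The basic inequality of least squares over a convex cone that contains the true mean. -/
theorem norm_sq_isotonicLSE_sub_le {μ : EuclideanSpace ℝ (Fin n)} (hμ : μ ∈ nondecreasingCone n)
    (x : EuclideanSpace ℝ (Fin n)) :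
    ‖isotonicLSE (μ + x) - μ‖ ^ 2 ≤ inner ℝ x (isotonicLSE (μ + x) - μ) := by
  obtain ⟨hP, hPK⟩ := isConeProjection_isotonicLSE (n := n)
  have h1 := hP.inner_self (μ + x)
  have h2 := hPK (μ + x) μ hμ
  set p := isotonicLSE (μ + x)
  rw [norm_sub_sq_real, inner_sub_right]
  rw [inner_add_left] at h1 h2
  rw [real_inner_self_eq_norm_sq] at h2
  rw [real_inner_comm] at h1
  linarith

theorem numPieces_eq_card_image (u : EuclideanSpace ℝ (Fin n)) :
    numPieces u = (Finset.univ.image fun i => u i).card := by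
  rw [numPieces, ← Set.ncard_coe_finset]
  simp

/-- The number of distinct values is the number of indices at which a value occurs for the first
time. -/
theorem measurable_numPieces : Measurable (numPieces (n := n)) := by
  classical
  have h : ∀ u : EuclideanSpace ℝ (Fin n),
      numPieces u = ∑ i, if ∀ j < i, u j ≠ u i then 1 else 0 := by
    intro u
    rw [numPieces_eq_card_image, Finset.sum_boole, Nat.cast_id,
      ← Finset.card_image_of_injOn (f := fun i => u i)]
    · congr 1
      refine (Finset.Subset.antisymm ?_ (Finset.image_subset_image (Finset.filter_subset _ _)))
      intro v hv
      obtain ⟨i, -, rfl⟩ := Finset.mem_image.1 hv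
      obtain ⟨m, hm, hmin⟩ := Finset.exists_min_image
        (Finset.univ.filter fun j => u j = u i) id ⟨i, by simp⟩
      simp only [Finset.mem_filter, Finset.mem_univ, true_and, id] at hm hmin
      refine Finset.mem_image.2 ⟨m, ?_, hm⟩
      simp only [Finset.mem_filter, Finset.mem_univ, true_and]
      exact fun j hj hjm => absurd (hmin j (hjm.trans hm)) (not_le.2 hj)
    · intro i hi j hj hij
      simp only [Finset.coe_filter, Finset.mem_univ, true_and] at hi hj
      rcases lt_trichotomy i j with hlt | heq | hlt
      · exact absurd hij (hj i hlt)
      · exact heq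
      · exact absurd hij.symm (hi j hlt)
  simp only [funext h]
  refine Finset.measurable_sum _ fun i _ => Measurable.ite ?_ measurable_const measurable_const
  have : {u : EuclideanSpace ℝ (Fin n) | ∀ j < i, u j ≠ u i} =
      ⋂ j, ⋂ _ : j < i, {u : EuclideanSpace ℝ (Fin n) | u j = u i}ᶜ := by
    ext u
    simp
  rw [this]
  exact MeasurableSet.iInter fun j => MeasurableSet.iInter fun _ =>
    (measurableSet_eq_fun (by fun_prop) (by fun_prop)).compl

theorem measurable_rHatUp (σ α : ℝ) : Measurable (rHatUp (n := n) σ α) := by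
  have h := isConeProjection_isotonicLSE (n := n).1.continuous.measurable
  have h2 : Measurable fun y : EuclideanSpace ℝ (Fin n) => (numPieces (isotonicLSE y) : ℝ) :=
    measurable_from_nat.comp (measurable_numPieces.comp h)
  unfold rHatUp
  fun_prop

theorem measurableSet_confidenceBall (σ α : ℝ) :
    MeasurableSet {p : EuclideanSpace ℝ (Fin n) × EuclideanSpace ℝ (Fin n) |
      p.2 ∈ confidenceBall σ α p.1} := by
  have h := isConeProjection_isotonicLSE (n := n).1.continuous
  refine measurableSet_le ?_ ((measurable_rHatUp σ α).comp measurable_fst)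
  simp only [scaledNormSq_eq_norm]
  exact Continuous.measurable (by fun_prop)

theorem exists_filter_eq_Icc {u : EuclideanSpace ℝ (Fin n)} (hu : u ∈ nondecreasingCone n)
    (i : Fin n) : ∃ a b, a ≤ b ∧ (Finset.univ.filter fun j => u j = u i) = Finset.Icc a b := by
  set s := Finset.univ.filter fun j => u j = u i
  have hs : s.Nonempty := ⟨i, by simp [s]⟩
  have hmem : ∀ j, j ∈ s ↔ u j = u i := fun j => by simp [s]
  refine ⟨s.min' hs, s.max' hs, s.min'_le _ (s.max'_mem hs), ?_⟩
  ext j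
  rw [Finset.mem_Icc]
  refine ⟨fun hj => ⟨s.min'_le j hj, s.le_max' j hj⟩, fun ⟨h1, h2⟩ => ?_⟩
  rw [hmem]
  exact le_antisymm ((hu h2).trans_eq ((hmem _).1 (s.max'_mem hs)))
    (((hmem _).1 (s.min'_mem hs)).symm.trans_le (hu h1))

/-- On each constant piece of the estimator, the error is a constant minus a nondecreasing sequence,
hence lies in the cone of nonincreasing sequences on that piece. The basic inequality then splits
over the pieces, and each of them contributes at most `σ² t`. -/
theorem norm_sq_isotonicLSE_sub_le_numPieces_mul {μ : EuclideanSpace ℝ (Fin n)}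
    (hμ : μ ∈ nondecreasingCone n) {σ : ℝ} (hσ : 0 < σ) (g : EuclideanSpace ℝ (Fin n)) {t : ℝ}
    (ht : ∀ a b : Fin n, a ≤ b → ∀ θ ∈ antitoneCone (Finset.Icc a b),
      2 * inner ℝ g θ - ‖θ‖ ^ 2 ≤ t) :
    ‖isotonicLSE (μ + σ • g) - μ‖ ^ 2 ≤ σ ^ 2 * numPieces (isotonicLSE (μ + σ • g)) * t := by
  classical
  have hbasic := norm_sq_isotonicLSE_sub_le hμ (σ • g)
  have hmon := (isotonicLSE_spec (μ + σ • g)).1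
  set m := isotonicLSE (μ + σ • g)
  set h := m - μ with hh
  -- The contribution of the piece on which the estimator takes the value `v`.
  have hpiece : ∀ v ∈ Finset.univ.image fun i => m i,
      ∑ i with m i = v, (2 * (h i * (σ * g i)) - h i ^ 2) ≤ σ ^ 2 * t := by
    intro v hv
    obtain ⟨i, -, rfl⟩ := Finset.mem_image.1 hv
    obtain ⟨a, b, hab, hI⟩ := exists_filter_eq_Icc hmon i
    have hmem : ∀ j, j ∈ Finset.Icc a b ↔ m j = m i := fun j => by rw [← hI]; simp
    set θ : EuclideanSpace ℝ (Fin n) :=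
      WithLp.toLp 2 fun j => if m j = m i then h j / σ else 0 with hθ
    have hθc : θ ∈ antitoneCone (Finset.Icc a b) := by
      refine ⟨fun j hj => ?_, fun j hj k hk hjk => ?_⟩
      · rw [hmem] at hj
        simp [hθ, hj]
      · rw [hmem] at hj hk
        simp only [hθ, hj, hk, if_true, hh, PiLp.sub_apply]
        exact div_le_div_of_nonneg_right (sub_le_sub_left (hμ hjk) _) hσ.le
    have h1 := mul_le_mul_of_nonneg_left (ht a b hab θ hθc) (sq_nonneg σ)
    refine le_trans (le_of_eq ?_) h1
    rw [PiLp.inner_apply, EuclideanSpace.real_norm_sq_eq, Finset.mul_sum,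
      ← Finset.sum_sub_distrib, Finset.mul_sum, Finset.sum_filter]
    refine Finset.sum_congr rfl fun j _ => ?_
    simp only [hθ, RCLike.inner_apply, conj_trivial]
    split_ifs
    · field_simp
    · simp
  have hsum := Finset.sum_le_sum hpiece
  rw [Finset.sum_fiberwise_of_maps_to fun i hi => Finset.mem_image_of_mem _ hi, Finset.sum_const,
    ← numPieces_eq_card_image, nsmul_eq_mul, Finset.sum_sub_distrib, ← Finset.mul_sum,
    ← EuclideanSpace.real_norm_sq_eq] at hsum
  have e : inner ℝ (σ • g) h = ∑ i, h i * (σ * g i) := by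
    simp [PiLp.inner_apply]
  rw [e] at hbasic
  linarith

end LeastSquares

/-! ### Numerical bounds -/

section Numerics

/-- The numerical choice of the exponent in the Chernoff bound, for a cone of statistical dimension
`m`: the bound sums to at most `α` over the `n (n + 1) / 2` intervals. -/
theorem exists_exponent {n : ℕ} (hn : 1 ≤ n) {α m : ℝ} (hα : 0 < α) (hα1 : α < 1) (hm1 : m ≤ n)
    (hm2 : m ≤ 2 * (1 + Real.log n)) :
    ∃ l : ℝ, 0 < l ∧ l * Real.pi ^ 2 / 2 < 1 ∧
      Real.exp (l * m / (1 - l * Real.pi ^ 2 / 2) -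
        l * (2 + 22 * Real.log n + 10 * Real.log (1 / α))) ≤ 2 * α / (n * (n + 1)) := by
  have hpi : Real.pi ^ 2 ≤ 9.8697 := by
    have := Real.pi_lt_d6
    nlinarith [Real.pi_pos]
  have hn0 : (0 : ℝ) < n := by exact_mod_cast hn
  have hlogα : Real.log α < 0 := Real.log_neg hα hα1
  have hlog2 := Real.log_two_gt_d9
  have hlog2' := Real.log_two_lt_d9
  have hrhs : Real.log (2 * α / (n * (n + 1))) =
      Real.log 2 + Real.log α - Real.log n - Real.log (n + 1) := by
    rw [Real.log_div (by positivity) (by positivity), Real.log_mul (by norm_num) hα.ne',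
      Real.log_mul hn0.ne' (by positivity)]
    ring
  have hfinish : ∀ l c : ℝ, 0 < l → 1 / 10 ≤ l → l * Real.pi ^ 2 / 2 < 1 →
      l * m ≤ c * (1 - l * Real.pi ^ 2 / 2) →
      c - l * (2 + 22 * Real.log n) ≤ Real.log 2 - Real.log n - Real.log (n + 1) →
      Real.exp (l * m / (1 - l * Real.pi ^ 2 / 2) -
        l * (2 + 22 * Real.log n + 10 * Real.log (1 / α))) ≤ 2 * α / (n * (n + 1)) := by
    intro l c hl hl10 ha hc h
    rw [← Real.le_log_iff_exp_le (by positivity), hrhs, one_div, Real.log_inv]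
    have h1 := (div_le_iff₀ (by linarith)).2 hc
    nlinarith
  have hstep : ∀ k : ℝ, 0 < k → Real.log (k + 1) ≤ Real.log k + 1 / k := by
    intro k hk
    have := Real.log_le_sub_one_of_pos (x := (k + 1) / k) (by positivity)
    rw [Real.log_div (by positivity) hk.ne'] at this
    have e : (k + 1) / k - 1 = 1 / k := by field_simp; ring
    linarith
  rcases Nat.lt_or_ge n 4 with h4 | h4
  · have hl : (1 / 10 : ℝ) * Real.pi ^ 2 / 2 < 1 := by linarith
    -- For small `n` the trivial bound `m ≤ n` is the better one, and `1 / 10` is the least exponent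
    -- for which `10 l log (1 / α)` dominates `log (1 / α)`.
    refine ⟨1 / 10, by norm_num, hl, hfinish _ (n / 5) (by norm_num) le_rfl hl ?_ ?_⟩
    · nlinarith
    · have h2 := hstep 2 (by norm_num)
      norm_num at h2
      interval_cases n
      · norm_num
      · norm_num
        linarith
      · have h3 : Real.log 4 = 2 * Real.log 2 := by
          rw [show (4 : ℝ) = 2 ^ 2 by norm_num, Real.log_pow]; norm_num
        have h5 := hstep 3 (by norm_num)
        norm_num at h5 ⊢
        linarith
  -- The exponent has to lie between `1 / 10` and `2 / π²`; `0.136` nearly maximizes the slack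
  -- `22 l - 2 - 2 l / (1 - l π² / 2)` in the coefficient of `log n`.
  · have hl : (0.136 : ℝ) * Real.pi ^ 2 / 2 < 1 := by linarith
    have h4' : (4 : ℝ) ≤ n := by exact_mod_cast h4
    have hlog4 : 1.386 ≤ Real.log n := by
      have := Real.log_le_log (by norm_num) h4'
      rw [show (4 : ℝ) = 2 ^ 2 by norm_num, Real.log_pow] at this
      norm_num at this ⊢
      linarith
    have hlogs : Real.log (n + 1) ≤ Real.log n + 1 / 4 := by
      have := hstep n hn0
      have e2 : (1 : ℝ) / n ≤ 1 / 4 := one_div_le_one_div_of_le (by norm_num) h4'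
      linarith
    refine ⟨0.136, by norm_num, hl, hfinish _ (0.8275 * (1 + Real.log n)) (by norm_num)
      (by norm_num) hl ?_ ?_⟩
    · have : 0.3288 ≤ 1 - (0.136 : ℝ) * Real.pi ^ 2 / 2 := by linarith
      nlinarith
    · linarith

end Numerics

/-! ### Coverage of the confidence ball -/

/-- Uniformly over all intervals, the squared norm of the projection of a standard Gaussian vector
onto the nonincreasing cone of the interval is at most `2 + 22 log n + 10 log (1 / α)`, except on an
event `B` of probability at most `α`. The bound is stated through the dual formula
`‖P g‖² = sup_θ (2 ⟪g, θ⟫ - ‖θ‖²)`. -/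
theorem stdGaussian_exists_antitone_gt_le {n : ℕ} (hn : 1 ≤ n) {α : ℝ} (hα : α ∈ Set.Ioo (0 : ℝ) 1) :
    ∃ B : Set (EuclideanSpace ℝ (Fin n)), MeasurableSet B ∧
      stdGaussian (EuclideanSpace ℝ (Fin n)) B ≤ ENNReal.ofReal α ∧
      ∀ g ∉ B, ∀ a b : Fin n, a ≤ b → ∀ θ ∈ antitoneCone (Finset.Icc a b),
        2 * inner ℝ g θ - ‖θ‖ ^ 2 ≤ 2 + 22 * Real.log n + 10 * Real.log (1 / α) := by
  choose P hP hPs using fun s : Finset (Fin n) => exists_isConeProjection_antitoneCone s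
  set t := 2 + 22 * Real.log n + 10 * Real.log (1 / α)
  set B : Fin n → Fin n → Set (EuclideanSpace ℝ (Fin n)) := fun a b =>
    {g | t < ‖P (Finset.Icc a b) g‖ ^ 2}
  have hBm : ∀ a b, MeasurableSet (B a b) := fun a b => by
    have := (hP (Finset.Icc a b)).continuous
    exact measurableSet_lt measurable_const (Continuous.measurable (by fun_prop))
  have hBle : ∀ a b, stdGaussian (EuclideanSpace ℝ (Fin n)) (B a b) ≤
      ENNReal.ofReal (2 * α / (n * (n + 1))) := by
    intro a b
    have hm1 := integral_norm_sq_le_card (hP (Finset.Icc a b))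
    have hm2 := integral_norm_sq_le_log (hP (Finset.Icc a b)) fun x => (hPs _ x).1
    rw [Fintype.card_fin] at hm1
    have hlog : Real.log (Finset.Icc a b).card ≤ Real.log n := by
      rcases Nat.eq_zero_or_pos (Finset.Icc a b).card with h0 | h0
      · rw [h0, Nat.cast_zero, Real.log_zero]
        exact Real.log_natCast_nonneg n
      · refine Real.log_le_log (by exact_mod_cast h0) ?_
        exact_mod_cast (Finset.card_le_univ _).trans_eq (Fintype.card_fin n)
    obtain ⟨l, hl, hl1, hle⟩ := exists_exponent hn hα.1 hα.2 hm1 (hm2.trans (by linarith))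
    exact ((hP (Finset.Icc a b)).measure_norm_sq_gt_le hl hl1 le_rfl t).trans
      (ENNReal.ofReal_le_ofReal hle)
  refine ⟨⋃ b, ⋃ a ∈ Finset.Iic b, B a b, MeasurableSet.iUnion fun b =>
    Finset.measurableSet_biUnion _ fun a _ => hBm a b, ?_, fun g hg a b hab θ hθ => ?_⟩
  · calc stdGaussian (EuclideanSpace ℝ (Fin n)) (⋃ b, ⋃ a ∈ Finset.Iic b, B a b)
        ≤ ∑ b, ∑ a ∈ Finset.Iic b, stdGaussian (EuclideanSpace ℝ (Fin n)) (B a b) := by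
          refine (measure_iUnion_fintype_le _ _).trans (Finset.sum_le_sum fun b _ => ?_)
          exact measure_biUnion_finset_le _ _
      _ ≤ ∑ b : Fin n, ∑ a ∈ Finset.Iic b, ENNReal.ofReal (2 * α / (n * (n + 1))) :=
          Finset.sum_le_sum fun b _ => Finset.sum_le_sum fun a _ => hBle a b
      _ = ((∑ b : Fin n, ((b : ℕ) + 1) : ℕ) : ℝ≥0∞) * ENNReal.ofReal (2 * α / (n * (n + 1))) := by
          simp [Finset.sum_const, ← Finset.sum_mul]
      _ = ENNReal.ofReal α := by
          have hgauss : (∑ b : Fin n, ((b : ℕ) + 1)) * 2 = (n + 1) * n := by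
            have h := Finset.sum_range_id_mul_two (n + 1)
            rw [Finset.sum_range_succ'] at h
            rw [Fin.sum_univ_eq_sum_range (fun b => b + 1) n]
            simpa using h
          have hcast : ((∑ b : Fin n, ((b : ℕ) + 1) : ℕ) : ℝ) = n * (n + 1) / 2 := by
            have : ((∑ b : Fin n, ((b : ℕ) + 1) : ℕ) : ℝ) * 2 = (n + 1) * n := by
              exact_mod_cast hgauss
            linarith
          rw [← ENNReal.ofReal_natCast, ← ENNReal.ofReal_mul (by positivity), hcast]
          congr 1
          have : (0 : ℝ) < n := by exact_mod_cast hn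
          field_simp
  · have h1 : ‖P (Finset.Icc a b) g‖ ^ 2 ≤ t := by
      by_contra! hlt
      exact hg (Set.mem_iUnion.2 ⟨b, Set.mem_iUnion₂.2 ⟨a, Finset.mem_Iic.2 hab, hlt⟩⟩)
    have h2 := (hPs (Finset.Icc a b) g).2 θ hθ
    have h3 := sq_nonneg ‖P (Finset.Icc a b) g - θ‖
    rw [norm_sub_sq_real] at h3
    linarith

theorem mainTheorem1 (n : ℕ) (hn : 1 ≤ n) (σ : ℝ) (hσ : 0 < σ) (α : ℝ)
    (hα : α ∈ Set.Ioo (0 : ℝ) 1) :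
    (∀ μ ∈ nondecreasingCone n,
      ENNReal.ofReal (1 - α) ≤
        observationLaw μ σ {y | scaledNormSq (isotonicLSE y - μ) ≤ rHatUp σ α y}) ∧
    IsHonestConfidenceSet (nondecreasingCone n) σ α (confidenceBall σ α) := by
  have hcov : ∀ μ ∈ nondecreasingCone n, ENNReal.ofReal (1 - α) ≤
      observationLaw μ σ {y | scaledNormSq (isotonicLSE y - μ) ≤ rHatUp σ α y} := by
    intro μ hμ
    obtain ⟨B, hBm, hB, hgood⟩ := stdGaussian_exists_antitone_gt_le hn hα
    have hS : MeasurableSet {y | scaledNormSq (isotonicLSE y - μ) ≤ rHatUp σ α y} :=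
      (measurableSet_confidenceBall σ α).preimage
        (f := fun y => (y, μ)) (by fun_prop)
    rw [observationLaw_eq_map, Measure.map_apply (by fun_prop) hS]
    calc ENNReal.ofReal (1 - α) = 1 - ENNReal.ofReal α := by
          rw [ENNReal.ofReal_sub _ hα.1.le, ENNReal.ofReal_one]
      _ ≤ 1 - stdGaussian (EuclideanSpace ℝ (Fin n)) B := tsub_le_tsub_left hB 1
      _ = stdGaussian (EuclideanSpace ℝ (Fin n)) Bᶜ := (prob_compl_eq_one_sub hBm).symm
      _ ≤ _ := by
          refine measure_mono fun g hg => ?_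
          have h := norm_sq_isotonicLSE_sub_le_numPieces_mul hμ hσ g (hgood g hg)
          change scaledNormSq (isotonicLSE (μ + σ • g) - μ) ≤ rHatUp σ α (μ + σ • g)
          rw [scaledNormSq_eq_norm, rHatUp, one_div_mul_eq_div]
          exact div_le_div_of_nonneg_right h (Nat.cast_nonneg n)
  exact ⟨hcov, measurableSet_confidenceBall σ α, le_iInf₂ hcov⟩
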